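/- Let $G$ be a locally finite group (that is, every finitely generated subgroup of $G$ is finite) of cardinality $|G| = \aleph_1$. Let $A$ be any abelian group, regarded as a $\mathbb{Z}$-module with trivial $G$-action, and let $AG = \mathbb{Z}G \otimes_{\mathbb{Z}} A$ be the induced left $\mathbb{Z}G$-module, on which $G$ acts by $g(x \otimes a) = gx \otimes a$. Then $H^1(G, AG) = 0$. -/

import Mathlib

open scoped MonoidAlgebra TensorProduct

universe u

/-- A group is locally finite if each of its finitely generated subgroups is finite. -/
def IsLocallyFiniteGroup (G : Type u) [Group G] : Prop :=
  ∀ H : Subgroup G, H.FG → Finite H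

/-- The induced module `kG ⊗_k A` of a `k`-module `A` with trivial `G`-action:
`g ∈ G` acts by `g • (x ⊗ a) = gx ⊗ a`. -/
noncomputable abbrev inducedRep (k G A : Type u) [CommRing k] [Group G] [AddCommGroup A]
    [Module k A] : Rep.{u} k G :=
  Rep.of (X := k[G] ⊗[k] A)
    ((Representation.leftRegular k G).tprod (Representation.trivial k G A))

/-- The induced module `AG = ℤG ⊗_ℤ A` of an abelian group `A` with trivial `G`-action.
The ring of integers is written `ULift.{u} ℤ` (the copy of `ℤ` in the universe `u`) because
`groupCohomology` asks for its ring, its group and its module in one universe; the scalar action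
of `ULift.{u} ℤ` on `A` is the usual action of `ℤ`. -/
noncomputable abbrev inducedModule (G A : Type u) [Group G] [AddCommGroup A] :
    Rep.{u} (ULift.{u} ℤ) G :=
  inducedRep (ULift.{u} ℤ) G A

/-!
A 1-cocycle with values in `k[G] ⊗ A`, that is in finitely supported functions `G → A`, is the
coboundary of an arbitrary function `f : G → A`, and `f` is almost invariant: each left translation
changes it at finitely many points. It is a coboundary of a finitely supported function as soon as
`f` is constant off a finite set, so the theorem says that an uncountable group in which all
elements have finite order "has one end" (`IsAlmostInvariant.exists_finite_ne`).

Call a subgroup `H` good if `f` is `H`-invariant off `H`. Every countable set lies in a countable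
good subgroup (`exists_countable_isInvariantOff`), and such a subgroup is proper because `G` is
uncountable. The core is that `f` is almost constant on every good proper subgroup `H`
(`finite_ne_of_isInvariantOff`); countable infinite sets then show that `f` is almost constant
on `G`.

For the core, fix `g ∉ H` and let `E` be the finite set where translation by `g` changes `f`. Given
`h, x ∈ H`, follow the path `h x, g h x, h g h x, g h g h x, …`. Steps by `h` preserve `f` outside
`H`, and steps by `g` preserve it outside `E`. Since `g h` has finite order, some power `(g h) ^ m`
with `m > 0` is in `H`; for the least such `m` the path ends in the coset `H g⁻¹ x`, where `f` is
constant, with value `f x` for almost all `x`. So `f (h x) ≠ f x` forces the path to meet `E`. If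
it meets `E` at `e` then `e x⁻¹ g` is a power of `h g` outside `H`, which confines `h` to one coset
of the centralizer in `H` of `e x⁻¹ g` (`exists_commute_of_apply_ne`). Applying this to two points
`x` with different values of `f`, the subgroup `H` is a finite union of cosets of centralizers of
elements outside `H`. By B. H. Neumann's lemma one of these centralizers has finite index in `H`,
and then `f` is almost constant on `H` after all (`finite_ne_of_finiteIndex_centralizer`).
-/

/-! ### Almost invariant functions on torsion groups -/

section AlmostInvariant

variable {G : Type*} [Group G] {α : Type*}

/-- The set of points at which left translation by `g` changes the value of `f`. -/
def changeSet (f : G → α) (g : G) : Set G := {x | f (g * x) ≠ f x}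

/-- A function on a group is almost invariant if every left translation changes it at only finitely
many points. -/
def IsAlmostInvariant (f : G → α) : Prop := ∀ g, (changeSet f g).Finite

/-- The function `f` is invariant under left translation by elements of `H`, except possibly on the
coset `H` itself. -/
def IsInvariantOff (f : G → α) (H : Subgroup G) : Prop := ∀ h ∈ H, ∀ x ∉ H, f (h * x) = f x

lemma apply_mul_eq_of_notMem_changeSet {f : G → α} {g x : G} (hx : x ∉ changeSet f g) :
    f (g * x) = f x := not_not.1 hx

/-- If `h` changes the value of `f` at `x`, then on the path `h * x`, `g * h * x`, `h * g * h * x`, …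
there is a point `e` at which translation by `g` changes `f`; the element `e * x⁻¹ * g` is a power
of `h * g`. Otherwise `f` is constant along the path up to its arrival in `H * g⁻¹ * x`. -/
lemma exists_commute_of_apply_ne {f : G → α} {H : Subgroup G} (hH : IsInvariantOff f H)
    {g h x : G} (hg : g ∉ H) (hh : h ∈ H) (hfin : IsOfFinOrder (g * h)) (hx : x ∈ H)
    (hgx : f (g⁻¹ * x) = f x) (hne : f (h * x) ≠ f x) :
    ∃ e ∈ changeSet f g, e * x⁻¹ * g ∉ H ∧ Commute (h * g) (e * x⁻¹ * g) := by
  classical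
  by_contra! hcon
  -- `m` is the first return time of the powers of `g * h` to `H`; before it, the path is off `H`.
  have hret : ∃ n, 0 < n ∧ (g * h) ^ n ∈ H := by
    obtain ⟨n, hn, h1⟩ := isOfFinOrder_iff_pow_eq_one.1 hfin
    exact ⟨n, hn, h1 ▸ H.one_mem⟩
  obtain ⟨m, ⟨hm0, hm⟩, hmin⟩ : ∃ m, (0 < m ∧ (g * h) ^ m ∈ H) ∧
      ∀ n < m, 0 < n → (g * h) ^ n ∉ H :=
    ⟨Nat.find hret, Nat.find_spec hret, fun n hn h0 h1 => Nat.find_min hret hn ⟨h0, h1⟩⟩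
  have hpath : ∀ n < m, f (h * ((g * h) ^ n * x)) = f (h * x) := by
    intro n
    induction n with
    | zero => simp
    | succ n ih =>
      intro hn
      have hout : (g * h) ^ (n + 1) ∉ H := hmin _ hn n.succ_pos
      have hpow : h * (g * h) ^ n * g = (h * g) ^ (n + 1) := by
        rw [mul_assoc, mul_pow_mul, ← mul_assoc, ← pow_succ']
      have hgood : h * ((g * h) ^ n * x) ∉ changeSet f g := by
        intro he
        have hz : h * ((g * h) ^ n * x) * x⁻¹ * g = (h * g) ^ (n + 1) := by
          rw [← hpow]; group
        refine hcon _ he ?_ ?_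
        · intro hzH
          apply hout
          have : (g * h) ^ (n + 1) = h⁻¹ * (h * ((g * h) ^ n * x) * x⁻¹ * g) * h := by
            rw [pow_succ]; group
          rw [this]
          exact H.mul_mem (H.mul_mem (H.inv_mem hh) hzH) hh
        · rw [hz]
          exact (Commute.refl _).pow_right _
      rw [← ih (by omega), ← apply_mul_eq_of_notMem_changeSet hgood,
        hH h hh _ (fun h' => hout ((H.mul_mem_cancel_right hx).1 h'))]
      congr 1
      rw [pow_succ']; group
  -- The last point of the path lies in `H * (g⁻¹ * x)`, a coset other than `H`.
  apply hne
  rw [← hpath (m - 1) (by omega), ← hgx]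
  have hpow : (g * h) ^ m = (g * h) ^ (m - 1) * (g * h) := by
    rw [← pow_succ, Nat.sub_add_cancel hm0]
  have : h * ((g * h) ^ (m - 1) * x) = h * (g * h) ^ m * h⁻¹ * (g⁻¹ * x) := by
    rw [hpow]; group
  rw [this]
  refine hH _ (H.mul_mem (H.mul_mem hh hm) (H.inv_mem hh)) _ fun h' => hg ?_
  simpa using (H.mul_mem_cancel_right hx).1 h'

/-- If `c ∈ H` commutes with `z ∉ H`, then `f (c * x)` agrees with `f (z * c * x) = f (c * z * x)`,
hence with `f (z * x)` and `f x`, for almost all `x ∈ H`. So `f` is almost constant on the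
centralizer of `z` in `H`, and by almost invariance also on each of its finitely many left cosets,
with the same value. -/
lemma finite_ne_of_finiteIndex_centralizer {f : G → α} (hf : IsAlmostInvariant f)
    {H : Subgroup G} (hH : IsInvariantOff f H) {z : G} (hz : z ∉ H)
    (hC : ((Subgroup.centralizer {z}).subgroupOf H).FiniteIndex) :
    ∃ c, {x | x ∈ H ∧ f x ≠ c}.Finite := by
  set C := (Subgroup.centralizer {z}).subgroupOf H
  have hpair : ∀ c ∈ C, ∀ x ∈ C, (c : G) ∉ changeSet f z → (x : G) ∉ changeSet f z →
      f c = f x := by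
    intro c hc x hx hcE hxE
    rw [← apply_mul_eq_of_notMem_changeSet hcE, ← apply_mul_eq_of_notMem_changeSet hxE]
    have hcx : (c * (x : G)⁻¹) * z = z * (c * (x : G)⁻¹) := by
      have := C.mul_mem hc (C.inv_mem hx)
      rw [Subgroup.mem_subgroupOf, Subgroup.mem_centralizer_singleton_iff] at this
      simpa only [Subgroup.coe_mul, Subgroup.coe_inv] using this
    have : z * (c : G) = (c * (x : G)⁻¹) * (z * x) := by
      rw [← mul_assoc, hcx, mul_assoc, inv_mul_cancel_right]
    rw [this]
    exact hH _ (H.mul_mem c.2 (H.inv_mem x.2)) _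
      fun h' => hz ((H.mul_mem_cancel_right x.2).1 h')
  obtain ⟨v, hv⟩ : ∃ v, ∀ c ∈ C, (c : G) ∉ changeSet f z → f c = v := by
    by_cases h : ∃ x ∈ C, (x : G) ∉ changeSet f z
    · obtain ⟨x, hx, hxE⟩ := h
      exact ⟨f x, fun c hc hcE => hpair c hc x hx hcE hxE⟩
    · push Not at h
      exact ⟨f 1, fun c hc hcE => absurd (h c hc) hcE⟩
  refine ⟨v, ?_⟩
  have : Finite (H ⧸ C) := Subgroup.finite_quotient_of_finiteIndex
  refine (Set.finite_iUnion fun q : H ⧸ C =>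
    ((hf q.out).union (hf z)).image fun x => (q.out : G) * x).subset ?_
  rintro x ⟨hxH, hxv⟩
  let q : H ⧸ C := QuotientGroup.mk ⟨x, hxH⟩
  have hq : q.out⁻¹ * ⟨x, hxH⟩ ∈ C := QuotientGroup.eq.1 (QuotientGroup.out_eq' q)
  refine Set.mem_iUnion.2 ⟨q, (q.out : G)⁻¹ * x, ?_, by simp⟩
  by_contra hn
  rw [Set.mem_union, not_or] at hn
  apply hxv
  rw [← hv _ hq hn.2]
  have := apply_mul_eq_of_notMem_changeSet hn.1
  simpa using this

/-- If `f` were not almost constant on `H`, then `H` would be a finite union of cosets of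
centralizers of elements outside `H`, none of finite index in `H`, against Neumann's lemma. -/
lemma finite_ne_of_isInvariantOff {f : G → α} (hf : IsAlmostInvariant f)
    (htor : ∀ g : G, IsOfFinOrder g)
    {H : Subgroup G} (hH : IsInvariantOff f H) (hHtop : H ≠ ⊤) :
    ∃ c, {x | x ∈ H ∧ f x ≠ c}.Finite := by
  classical
  obtain ⟨g, hg⟩ : ∃ g, g ∉ H := by
    by_contra! h
    exact hHtop ((Subgroup.eq_top_iff' H).2 h)
  by_cases hconst : ∃ c, ∀ x ∈ H, f (g⁻¹ * x) = f x → f x = c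
  · obtain ⟨c, hc⟩ := hconst
    exact ⟨c, (hf g⁻¹).subset fun x hx h => hx.2 (hc x hx.1 h)⟩
  -- Each `y ∈ H` has `f y ≠ f x₀` or `f y ≠ f x₁`, so two base points account for all of `H`.
  push Not at hconst
  obtain ⟨x₀, hx₀, hgx₀, -⟩ := hconst (f 1)
  obtain ⟨x₁, hx₁, hgx₁, hne⟩ := hconst (f x₀)
  by_contra hnot
  have hbad : ∀ z ∉ H, ¬ ((Subgroup.centralizer {z}).subgroupOf H).FiniteIndex :=
    fun z hz hC => hnot (finite_ne_of_finiteIndex_centralizer hf hH hz hC)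
  -- A pair `(e, x)` stands for the set of `y ∈ H` such that `y * x⁻¹ * g` centralizes
  -- `e * x⁻¹ * g`. Its inverse is empty or a left coset of a centralizer in `H`.
  let S : Finset (G × G) :=
    ((hf g).toFinset ×ˢ {x₀, x₁}).filter fun p => p.1 * p.2⁻¹ * g ∉ H
  let P : G × G → H → Prop := fun p y => Commute ((y : G) * p.2⁻¹ * g) (p.1 * p.2⁻¹ * g)
  have hcover : ∀ y : H, ∃ p ∈ S, P p y := by
    intro y
    have key : ∀ x ∈ ({x₀, x₁} : Finset G), x ∈ H → f (g⁻¹ * x) = f x → f y ≠ f x →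
        ∃ p ∈ S, P p y := by
      intro x hx hxH hgx hyx
      obtain ⟨e, he, heH, hcomm⟩ := exists_commute_of_apply_ne hH hg
        (H.mul_mem y.2 (H.inv_mem hxH)) (htor _) hxH hgx (by simpa using hyx)
      refine ⟨(e, x), ?_, hcomm⟩
      simp only [S, Finset.mem_filter, Finset.mem_product, Set.Finite.mem_toFinset]
      exact ⟨⟨he, hx⟩, heH⟩
    by_cases hy : f y = f x₀
    · exact key x₁ (by simp) hx₁ hgx₁ fun h => hne (h ▸ hy)
    · exact key x₀ (by simp) hx₀ hgx₀ hy
  let K : G × G → Subgroup H := fun p => (Subgroup.centralizer {p.1 * p.2⁻¹ * g}).subgroupOf H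
  let t : G × G → H := fun p => if h : ∃ y, P p y then h.choose⁻¹ else 1
  obtain ⟨p, hp, hfin⟩ := Subgroup.exists_finiteIndex_of_leftCoset_cover (H := K) (g := t)
    (s := S) (by
      refine Set.eq_univ_of_forall fun y => ?_
      obtain ⟨p, hp, hy⟩ := hcover y⁻¹
      refine Set.mem_iUnion₂.2 ⟨p, hp, ?_⟩
      have hex : ∃ y, P p y := ⟨_, hy⟩
      have ht : P p hex.choose := hex.choose_spec
      rw [Set.mem_smul_set_iff_inv_smul_mem, smul_eq_mul, SetLike.mem_coe,
        Subgroup.mem_subgroupOf, Subgroup.mem_centralizer_singleton_iff]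
      simp only [t, dif_pos hex, inv_inv]
      have := ht.mul_left hy.inv_left
      have e : ((hex.choose : G) * p.2⁻¹ * g) * (((y⁻¹ : H) : G) * p.2⁻¹ * g)⁻¹ =
          ((hex.choose * y : H) : G) := by
        push_cast; group
      rw [e] at this
      exact this)
  exact hbad _ (Finset.mem_filter.1 hp).2 hfin

lemma countable_closure {S : Set G} (hS : S.Countable) :
    (Subgroup.closure S : Set G).Countable := by
  have := hS.to_subtype
  have : Countable (FreeGroup S) := inferInstanceAs (Countable (Quot _))
  rw [← Subtype.range_coe (s := S), ← FreeGroup.range_lift_eq_closure]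
  exact Set.countable_range _

/-- The subgroup is the union of an increasing sequence, each term of which absorbs the finitely many
exceptional points of every element of the preceding term. -/
lemma exists_countable_isInvariantOff {f : G → α} (hf : IsAlmostInvariant f) {S : Set G}
    (hS : S.Countable) :
    ∃ H : Subgroup G, S ⊆ H ∧ (H : Set G).Countable ∧ IsInvariantOff f H := by
  have hstep : ∀ K : {K : Subgroup G // (K : Set G).Countable},
      ∃ K' : {K : Subgroup G // (K : Set G).Countable},
        K.1 ≤ K'.1 ∧ ∀ k ∈ K.1, changeSet f k ⊆ K'.1 := by
    rintro ⟨K, hK⟩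
    refine ⟨⟨Subgroup.closure (K ∪ ⋃ k ∈ (K : Set G), changeSet f k),
      countable_closure (hK.union (hK.biUnion fun k _ => (hf k).countable))⟩, ?_, ?_⟩
    · exact fun k hk => Subgroup.subset_closure (Or.inl hk)
    · exact fun k hk x hx => Subgroup.subset_closure (Or.inr (Set.mem_biUnion hk hx))
  choose next hle habs using hstep
  let M : ℕ → {K : Subgroup G // (K : Set G).Countable} :=
    fun n => next^[n] ⟨Subgroup.closure S, countable_closure hS⟩
  have hM : ∀ n, M (n + 1) = next (M n) := fun n => Function.iterate_succ_apply' next n _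
  let N : ℕ → Subgroup G := fun n => (M n).1
  have hmono : Monotone N := monotone_nat_of_le_succ fun n => by
    simpa only [N, hM] using hle (M n)
  have hmem : ∀ x, x ∈ ⨆ n, N n ↔ ∃ n, x ∈ N n := fun x =>
    Subgroup.mem_iSup_of_directed hmono.directed_le
  refine ⟨⨆ n, N n, fun s hs => (hmem s).2 ⟨0, Subgroup.subset_closure hs⟩, ?_, ?_⟩
  · refine (Set.countable_iUnion fun n => (M n).2).mono fun x hx => ?_
    exact Set.mem_iUnion.2 ((hmem x).1 hx)
  · intro h hh x hx
    obtain ⟨n, hn⟩ := (hmem h).1 hh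
    by_contra hne
    refine hx ((hmem x).2 ⟨n + 1, ?_⟩)
    have := habs (M n) h hn hne
    rwa [← hM] at this

/-- An almost invariant function on an uncountable torsion group is constant off a finite set. -/
theorem IsAlmostInvariant.exists_finite_ne [Uncountable G] {f : G → α}
    (hf : IsAlmostInvariant f) (htor : ∀ g : G, IsOfFinOrder g) :
    ∃ c, {x | f x ≠ c}.Finite := by
  have hgood : ∀ S : Set G, S.Countable →
      ∃ T : Set G, S ⊆ T ∧ ∃ c, {x | x ∈ T ∧ f x ≠ c}.Finite := by
    intro S hS
    obtain ⟨H, hSH, hHc, hH⟩ := exists_countable_isInvariantOff hf hS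
    refine ⟨H, hSH, finite_ne_of_isInvariantOff hf htor hH ?_⟩
    rintro rfl
    exact Set.not_countable_univ hHc
  -- A countably infinite set pins down the value that `f` takes almost everywhere on any
  -- larger countable set.
  let S₀ : Set G := Set.range (Infinite.natEmbedding G)
  have hS₀ : S₀.Infinite := Set.infinite_range_of_injective (Infinite.natEmbedding G).injective
  obtain ⟨T₀, hST₀, c, hc⟩ := hgood S₀ (Set.countable_range _)
  refine ⟨c, ?_⟩
  by_contra hinf
  obtain ⟨D, hD, hDinf, hDc⟩ : ∃ D ⊆ {x | f x ≠ c}, D.Infinite ∧ D.Countable := by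
    let i := Set.Infinite.natEmbedding _ hinf
    refine ⟨Set.range fun n => (i n : G), ?_,
      Set.infinite_range_of_injective (Subtype.val_injective.comp i.injective),
      Set.countable_range _⟩
    rintro _ ⟨n, rfl⟩
    exact (i n).2
  obtain ⟨T, hT, c', hc'⟩ := hgood (S₀ ∪ D) ((Set.countable_range _).union hDc)
  obtain rfl : c = c' := by
    by_contra hcc
    refine hS₀ ((hc.union hc').subset fun x hx => ?_)
    by_cases hxc : f x = c
    · exact Or.inr ⟨hT (Or.inl hx), fun h => hcc (hxc.symm.trans h)⟩
    · exact Or.inl ⟨hST₀ hx, hxc⟩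
  exact hDinf (hc'.subset fun x hx => ⟨hT (Or.inr hx), hD hx⟩)

end AlmostInvariant

/-! ### First cohomology of the induced module -/

section Cohomology

variable {k G A : Type u} [CommRing k] [Group G] [AddCommGroup A] [Module k A]

open scoped Classical in
/-- The induced module `k[G] ⊗ A` as the module of finitely supported functions `G → A`. -/
noncomputable def inducedEquiv (k G A : Type u) [CommRing k] [Group G] [AddCommGroup A]
    [Module k A] : (k[G] ⊗[k] A) ≃ₗ[k] (G →₀ A) :=
  TensorProduct.congr (MonoidAlgebra.coeffLinearEquiv k) (LinearEquiv.refl k A) ≪≫ₗ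
    TensorProduct.finsuppScalarLeft k A G

lemma inducedEquiv_ρ (g : G) (v : k[G] ⊗[k] A) (x : G) :
    inducedEquiv k G A ((inducedRep k G A).ρ g v) x = inducedEquiv k G A v (g⁻¹ * x) := by
  induction v using TensorProduct.induction_on with
  | zero => simp
  | add v w hv hw => simp only [map_add, Finsupp.add_apply, hv, hw]
  | tmul p a =>
    have : (inducedRep k G A).ρ g (p ⊗ₜ[k] a) = (Representation.leftRegular k G g p) ⊗ₜ[k] a := rfl
    rw [this]
    simp [inducedEquiv, TensorProduct.finsuppScalarLeft_apply_tmul_apply,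
      Representation.coeff_ofMulAction]

/-- A cocycle `d` with values in finitely supported functions is the coboundary, among arbitrary
functions, of the diagonal `x ↦ d x x`; that diagonal is almost invariant, and subtracting from it
its value almost everywhere makes it finitely supported. -/
theorem subsingleton_H1_inducedRep [Uncountable G] (htor : ∀ g : G, IsOfFinOrder g) :
    Subsingleton (groupCohomology (inducedRep k G A) 1) := by
  refine subsingleton_of_forall_eq 0 fun y => ?_
  induction y using groupCohomology.H1_induction_on with
  | h d =>
  rw [groupCohomology.H1π_eq_zero_iff]
  let D : G → G →₀ A := fun g => inducedEquiv k G A (d g)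
  have hD : ∀ g h x, D (g * h) x = D h (g⁻¹ * x) + D g x := by
    intro g h x
    have := (groupCohomology.mem_cocycles₁_iff _).1 d.2 g h
    have hx := congr_arg (fun v => inducedEquiv k G A v x) this
    simp only [map_add, Finsupp.add_apply] at hx
    exact hx.trans (congr_arg (· + _) (inducedEquiv_ρ g (d h) x))
  let f : G → A := fun x => D x x
  have hDf : ∀ g x, D g x = f x - f (g⁻¹ * x) := by
    intro g x
    have := hD g (g⁻¹ * x) x
    rw [mul_inv_cancel_left] at this
    simp only [f]
    rw [this, add_sub_cancel_left]
  have hf : IsAlmostInvariant f := by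
    intro g
    refine ((D g⁻¹).support.finite_toSet).subset fun x hx => ?_
    rw [Finset.mem_coe, Finsupp.mem_support_iff, hDf, inv_inv]
    exact sub_ne_zero.2 (Ne.symm hx)
  obtain ⟨c, hc⟩ := hf.exists_finite_ne htor
  have hfin : (Function.support fun x => c - f x).Finite :=
    hc.subset fun x hx h => hx (by simp [h])
  let u : G →₀ A := Finsupp.ofSupportFinite _ hfin
  refine ⟨(inducedEquiv k G A).symm u, ?_⟩
  funext g
  apply (inducedEquiv k G A).injective
  ext x
  change inducedEquiv k G A ((inducedRep k G A).ρ g ((inducedEquiv k G A).symm u) -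
    (inducedEquiv k G A).symm u) x = D g x
  rw [map_sub, Finsupp.sub_apply, inducedEquiv_ρ, LinearEquiv.apply_symm_apply, hDf]
  change (c - f (g⁻¹ * x)) - (c - f x) = _
  abel

end Cohomology

lemma IsLocallyFiniteGroup.isOfFinOrder {G : Type u} [Group G] (hG : IsLocallyFiniteGroup G)
    (g : G) : IsOfFinOrder g := by
  have : (Subgroup.zpowers g : Set G).Finite := hG _ (Subgroup.zpowers_eq_closure g ▸ ⟨{g}, by simp⟩)
  exact finite_powers.1 (this.subset fun _ h => Submonoid.powers_le.2 (Subgroup.mem_zpowers g) h)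

theorem theorem5p3 {G : Type u} [Group G] (hG : IsLocallyFiniteGroup G)
    (hcard : Cardinal.mk G = Cardinal.aleph 1) (A : Type u) [AddCommGroup A] :
    Subsingleton (groupCohomology (inducedModule G A) 1) := by
  have : Uncountable G := by
    rw [← Cardinal.aleph0_lt_mk_iff, hcard]
    exact Cardinal.aleph0_lt_aleph_one
  exact subsingleton_H1_inducedRep hG.isOfFinOrder
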